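/- Let $n\ge 1$ and let $a_1,\dots,a_n$ be positive integers. Let $p,q>0$ be relatively prime integers with \[ \frac pq=[0,a_1,\dots,a_n]=\cfrac{1}{a_1+\cfrac{1}{a_2+\ddots+\cfrac{1}{a_n}}}. \] Let $D$ be the standard (alternating) 4-plat diagram encoded by $[0,a_1,\dots,a_n]$: four horizontal strands, numbered $1,2,3,4$ from top to bottom; at the left end strand $1$ is joined with $2$ and strand $3$ with $4$; from left to right there are $n$ twist boxes, the $k$-th consisting of $a_k$ consecutive crossings, between strands $2,3$ with the overcrossing strand of positive slope if $k$ is odd, and between strands $1,2$ with the overcrossing strand of negative slope if $k$ is even; at the right end $1$ is joined with $2$ and $3$ with $4$ if $n$ is odd, and $1$ with $4$ and $2$ with $3$ if $n$ is even. Give $D$ any orientation, let $w(D)$ be its writhe and $L$ the oriented link that it represents. Let \[ V_L(t)=(-A^{-3})^{w(D)}\langle D\rangle\big|_{A=t^{-1/4}} \] be the Jones polynomial, where $\langle D\rangle$ is the Kauffman bracket, normalized to be $1$ on a circle without crossings. Then, with $t^{-1/4}=e^{i\pi/4}=\frac{1+i}{\sqrt2}$ as the fourth root used at $t=-1$ (so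 that $t^{1/2}=-i$), \[ V_L(-1)=(-1)^{\binom n2}\, i^{n}\left(\frac{1+i}{\sqrt2}\right)^{w(D)+\sum_{k=1}^n(-1)^k a_k} q . \] -/

import Mathlib

open scoped LaurentPolynomial

/-- A crossing of two horizontally running neighbouring strands. The four strands are numbered
`0, 1, 2, 3` from top to bottom, and the crossing exchanges the strands `pos` and `pos + 1`.
`twist` is the twist sign: it is `1` if the overcrossing strand is the one of positive slope
(it runs from lower left to upper right) and `-1` if it is the one of negative slope. -/
structure PlatCrossing where
  pos : Fin 3
  twist : ℤˣ

/-- The upper one of the two strands meeting at the crossing. -/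
def PlatCrossing.upper (c : PlatCrossing) : Fin 4 := c.pos.castSucc

/-- The lower one of the two strands meeting at the crossing. -/
def PlatCrossing.lower (c : PlatCrossing) : Fin 4 := c.pos.succ

/-- The pairing of the four strands that joins the two upper ones and the two lower ones. -/
def adjacentCap : Fin 4 → Fin 4 := ![1, 0, 3, 2]

/-- The pairing of the four strands that joins the two outer ones and the two inner ones. -/
def nestedCap : Fin 4 → Fin 4 := ![3, 2, 1, 0]

/-- An unoriented 4-plat diagram: four horizontal strands, joined by `adjacentCap` at the left end,
with crossings listed from left to right, and joined at the right end by `nestedCap` or by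
`adjacentCap`. -/
structure FourPlat where
  word : List PlatCrossing
  nested : Bool

namespace FourPlat

/-- The number of crossings. -/
abbrev size (D : FourPlat) : ℕ := D.word.length

/-- The `j`-th crossing from the left. -/
def crossing (D : FourPlat) (j : Fin D.size) : PlatCrossing := D.word.get j

/-- The pairing of the strands at the right end. -/
def rightCap (D : FourPlat) : Fin 4 → Fin 4 := if D.nested then nestedCap else adjacentCap

/-- The points at which the diagram is cut by vertical lines placed to the left of, between, and to
the right of the crossings: `(j, i)` is the point of the `j`-th line on the `i`-th strand, so that
crossing `j` lies between the lines `j` and `j + 1`. -/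
abbrev Point (D : FourPlat) : Type := Fin (D.size + 1) × Fin 4

/-- A Kauffman state chooses a smoothing at each crossing: `true` is the `A`-smoothing, `false` the
`B`-smoothing. -/
abbrev State (D : FourPlat) : Type := Fin D.size → Bool

/-- The smoothing at crossing `j` consists of two horizontal arcs. The `A`-smoothing joins the two
regions swept out when the overcrossing strand is turned counterclockwise. If that strand has
positive slope these are the upper and the lower region, and the `A`-smoothing has two vertical
arcs `)(`; if it has negative slope these are the left and the right region, and the `A`-smoothing
has two horizontal arcs. -/
def IsHorizontal (D : FourPlat) (s : D.State) (j : Fin D.size) : Prop :=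
  ((D.crossing j).twist = 1 ∧ s j = false) ∨ ((D.crossing j).twist = -1 ∧ s j = true)

/-- Two points are joined by an elementary arc of the smoothed diagram. -/
inductive Joined (D : FourPlat) (s : D.State) : D.Point → D.Point → Prop
  | left (i : Fin 4) : Joined D s (0, i) (0, adjacentCap i)
  | right (i : Fin 4) : Joined D s (Fin.last _, i) (Fin.last _, D.rightCap i)
  | straight (j : Fin D.size) (i : Fin 4) (hu : i ≠ (D.crossing j).upper)
      (hl : i ≠ (D.crossing j).lower) : Joined D s (j.castSucc, i) (j.succ, i)
  | upper (j : Fin D.size) (h : D.IsHorizontal s j) :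
      Joined D s (j.castSucc, (D.crossing j).upper) (j.succ, (D.crossing j).upper)
  | lower (j : Fin D.size) (h : D.IsHorizontal s j) :
      Joined D s (j.castSucc, (D.crossing j).lower) (j.succ, (D.crossing j).lower)
  | west (j : Fin D.size) (h : ¬ D.IsHorizontal s j) :
      Joined D s (j.castSucc, (D.crossing j).upper) (j.castSucc, (D.crossing j).lower)
  | east (j : Fin D.size) (h : ¬ D.IsHorizontal s j) :
      Joined D s (j.succ, (D.crossing j).upper) (j.succ, (D.crossing j).lower)

/-- The number of closed curves of the smoothed diagram, which are its connected components
(`Quot` is the quotient by the equivalence relation generated by `Joined`). -/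
noncomputable def loops (D : FourPlat) (s : D.State) : ℕ := Nat.card (Quot (D.Joined s))

/-- The number of `A`-smoothings minus the number of `B`-smoothings. -/
def stateExponent (D : FourPlat) (s : D.State) : ℤ := ∑ j, if s j then 1 else -1

/-- The Kauffman bracket as a Laurent polynomial in `A`, here the variable `T 1`; it is normalized
so that the bracket of a circle without crossings is `1`. -/
noncomputable def bracket (D : FourPlat) : ℤ[T;T⁻¹] :=
  ∑ s : D.State, LaurentPolynomial.T (D.stateExponent s) *
    (-LaurentPolynomial.T 2 - LaurentPolynomial.T (-2)) ^ (D.loops s - 1)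

/-- An orientation of the link diagram: `dir j i` is `1` if the strand through the point `(j, i)`
runs from left to right there, and `-1` if it runs from right to left. The fields say that the
directions match along the arcs at both ends and along the two strands of each crossing. -/
structure Orientation (D : FourPlat) where
  dir : Fin (D.size + 1) → Fin 4 → ℤˣ
  left : ∀ i, dir 0 (adjacentCap i) = -dir 0 i
  right : ∀ i, dir (Fin.last _) (D.rightCap i) = -dir (Fin.last _) i
  pass : ∀ (j : Fin D.size) (i : Fin 4),
    dir j.succ (Equiv.swap (D.crossing j).upper (D.crossing j).lower i) = dir j.castSucc i

namespace Orientation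

variable {D : FourPlat}

/-- The sign of a crossing in the oriented diagram: `1` if turning the direction of the overcrossing
strand counterclockwise by a right angle gives that of the undercrossing strand, else `-1`.
If both strands run from left to right and the overcrossing strand is the one of positive slope
(twist sign `1`), this is `-1`, and the sign changes with each reversal of a strand and with the
exchange of over and under. -/
def crossingSign (o : D.Orientation) (j : Fin D.size) : ℤˣ :=
  -((D.crossing j).twist * o.dir j.castSucc (D.crossing j).upper *
    o.dir j.castSucc (D.crossing j).lower)

/-- The writhe of the oriented diagram. -/
def writhe (o : D.Orientation) : ℤ := ∑ j, (o.crossingSign j : ℤ)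

/-- The normalized bracket `(-A⁻³) ^ w(D) * ⟨D⟩`, a Laurent polynomial in `A`. -/
noncomputable def normalizedBracket (o : D.Orientation) : ℤ[T;T⁻¹] :=
  LaurentPolynomial.C ((o.writhe.negOnePow : ℤˣ) : ℤ) * LaurentPolynomial.T (-3 * o.writhe) *
    D.bracket

/-- The Jones polynomial, written as a Laurent polynomial in `t ^ (1/4)`: the normalized bracket with
`A = t ^ (-1/4)`. -/
noncomputable def jones (o : D.Orientation) : ℤ[T;T⁻¹] :=
  LaurentPolynomial.invert o.normalizedBracket

/-- The value of the Jones polynomial at `t = u ^ 4`, where `u` is the chosen value of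
`t ^ (1/4)`. -/
noncomputable def jonesEval (o : D.Orientation) (u : ℂˣ) : ℂ :=
  LaurentPolynomial.eval₂ (Int.castRingHom ℂ) u o.jones

end Orientation

/-- The standard diagram encoded by `[0, a₁, …, aₙ]`, where the entry with index `k : Fin n` is
`a_{k+1}`. The `i`-th twist box consists of `|a_i|` crossings of twist sign
`(-1) ^ (i - 1) * sign a_i`, between the second and third strands if `i` is odd and between the first
and second strands if `i` is even. At the right end the outer and the inner strands are joined if `n`
is even, the two upper and the two lower strands if `n` is odd. -/
def standard {n : ℕ} (a : Fin n → ℤ) : FourPlat where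
  word := (List.ofFn fun k : Fin n =>
    List.replicate (a k).natAbs
      { pos := if Even (k : ℕ) then 1 else 0
        twist := (-1) ^ (k : ℕ) * (if 0 < a k then 1 else -1) : PlatCrossing }).flatten
  nested := decide (Even n)

end FourPlat

/-- The value of the continued fraction `[0, a₁, …, aₙ] = 1 / (a₁ + 1 / (a₂ + ⋯ + 1 / aₙ))`. -/
def contFracValue : List ℤ → ℚ
  | [] => 0
  | a :: l => 1 / (a + contFracValue l)

/-- The value `exp (-iπ/4) = (1 - i) / √2` of `t ^ (1/4)` at `t = -1`, which corresponds to
`A = t ^ (-1/4) = exp (iπ/4)`. -/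
noncomputable def quarterRoot : ℂˣ where
  val := (1 - Complex.I) / (Real.sqrt 2 : ℂ)
  inv := (1 + Complex.I) / (Real.sqrt 2 : ℂ)
  val_inv := by
    have h : ((Real.sqrt 2 : ℝ) : ℂ) * (Real.sqrt 2 : ℝ) = 2 := by
      rw [← Complex.ofReal_mul, Real.mul_self_sqrt (by norm_num)]; norm_num
    rw [div_mul_div_comm, h]
    ring_nf
    rw [Complex.I_sq]; norm_num
  inv_val := by
    have h : ((Real.sqrt 2 : ℝ) : ℂ) * (Real.sqrt 2 : ℝ) = 2 := by
      rw [← Complex.ofReal_mul, Real.mul_self_sqrt (by norm_num)]; norm_num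
    rw [div_mul_div_comm, h]
    ring_nf
    rw [Complex.I_sq]; norm_num

theorem quarterRoot_pow_four : (quarterRoot : ℂ) ^ 4 = -1 := by
  have h : ((Real.sqrt 2 : ℝ) : ℂ) ^ 2 = 2 := by
    rw [← Complex.ofReal_pow, Real.sq_sqrt (by norm_num)]; norm_num
  have h4 : ((Real.sqrt 2 : ℝ) : ℂ) ^ 4 = 4 := by
    rw [show (4 : ℕ) = 2 * 2 from rfl, pow_mul, h]; norm_num
  have hI : (1 - Complex.I) ^ 4 = -4 := by
    have : (1 - Complex.I) ^ 2 = -2 * Complex.I := by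
      ring_nf
      rw [Complex.I_sq]; ring
    rw [show (4 : ℕ) = 2 * 2 from rfl, pow_mul, this, mul_pow, Complex.I_sq]; norm_num
  change ((1 - Complex.I) / (Real.sqrt 2 : ℂ)) ^ 4 = -1
  rw [div_pow, h4, hI]; norm_num

/-! With `A = exp (iπ/4)` one has `A ^ 2 = i`, so the loop value `-A ^ 2 - A ^ (-2)` is zero and the
bracket is the weighted count of the states with a single loop. These are counted by removing
crossings from the left. A horizontal smoothing changes nothing; a vertical one either exchanges the
adjacent and nested left caps or splits off a closed curve, which makes the contribution zero. Hence
the two sums, one for each left cap, obey a linear recursion. Over a twist box it becomes, up to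
powers of `i` and `A`, the continuant step `(p, q) ↦ (q, m q + p)` (`connectedSum_replicate_one`,
`connectedSum_replicate_zero`, `connectedSum_twistBoxes`). The writhe factor becomes `A ^ w` because
`A ^ 4 = -1` (`Orientation.jonesEval_inv`), and coprimality identifies the last continuant with `q`
(`continuants_snd_eq`). -/

namespace FourPlat

/-! ### Connectedness through labellings -/

/-- The compatibility of labels `g`, `h` of the four strands on the two sides of the crossing `c`
with its smoothing, which is horizontal if `hor` holds and vertical otherwise. -/
def SmoothingCompatible (c : PlatCrossing) (hor : Prop) (g h : Fin 4 → Prop) : Prop :=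
  (∀ i, i ≠ c.upper → i ≠ c.lower → g i = h i) ∧
    (hor → g c.upper = h c.upper ∧ g c.lower = h c.lower) ∧
    (¬ hor → g c.upper = g c.lower ∧ h c.upper = h c.lower)

/-- The smoothing `b` of the crossing `c` has two horizontal arcs. -/
def HorizontalSmoothing (c : PlatCrossing) (b : Bool) : Prop :=
  (c.twist = 1 ∧ b = false) ∨ (c.twist = -1 ∧ b = true)

/-- The smoothed diagram with left cap `L`, crossings `l` and right cap `R` is connected: every
labelling of its points that is constant along arcs is constant. -/
def IsConnected (L R : Fin 4 → Fin 4) (l : List PlatCrossing) (s : Fin l.length → Bool) : Prop :=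
  ∀ f : Fin (l.length + 1) → Fin 4 → Prop, (∀ i, f 0 i = f 0 (L i)) →
    (∀ i, f (Fin.last _) i = f (Fin.last _) (R i)) →
    (∀ j : Fin l.length, SmoothingCompatible (l.get j) (HorizontalSmoothing (l.get j) (s j))
      (f j.castSucc) (f j.succ)) → ∀ j i, f j i = f 0 0

/-- Predicates suffice as labels: membership in the class of `a` is itself an invariant predicate.
-/
theorem subsingleton_quot_iff {α : Type*} (r : α → α → Prop) (a : α) :
    Subsingleton (Quot r) ↔
      ∀ f : α → Prop, (∀ x y, r x y → f x = f y) → ∀ x, f x = f a := by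
  constructor
  · intro h f hf x
    exact congrArg (Quot.lift f hf) (Subsingleton.elim (Quot.mk r x) (Quot.mk r a))
  · intro h
    have key : ∀ x, Quot.mk r x = Quot.mk r a := fun x => by
      have := h (fun x => Quot.mk r x = Quot.mk r a)
        (fun x y hxy => by simp only [Quot.sound hxy]) x
      simpa using this
    refine ⟨fun x y => ?_⟩
    induction x using Quot.ind with | _ x
    induction y using Quot.ind with | _ y
    rw [key x, key y]

theorem subsingleton_quot_joined_iff (D : FourPlat) (s : D.State) :
    Subsingleton (Quot (D.Joined s)) ↔ IsConnected adjacentCap D.rightCap D.word s := by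
  rw [subsingleton_quot_iff _ ((0 : Fin (D.size + 1)), (0 : Fin 4))]
  constructor
  · intro h f hl hr hc j i
    refine h (fun x => f x.1 x.2) ?_ (j, i)
    rintro _ _ (i | i | ⟨j, i, hu, hl⟩ | ⟨j, hj⟩ | ⟨j, hj⟩ | ⟨j, hj⟩ | ⟨j, hj⟩)
    · exact hl i
    · exact hr i
    · exact (hc j).1 i hu hl
    · exact ((hc j).2.1 hj).1
    · exact ((hc j).2.1 hj).2
    · exact ((hc j).2.2 hj).1
    · exact ((hc j).2.2 hj).2
  · intro h f hf x
    refine h (fun j i => f (j, i)) (fun i => hf _ _ (.left i)) (fun i => hf _ _ (.right i))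
      (fun j => ⟨fun i hu hl => hf _ _ (.straight j i hu hl), fun hj => ⟨hf _ _ (.upper j hj),
        hf _ _ (.lower j hj)⟩, fun hj => ⟨hf _ _ (.west j hj), hf _ _ (.east j hj)⟩⟩) x.1 x.2

/-- When the loop value is zero, `0 ^ (loops - 1)` is the indicator of this condition. The truncated
subtraction is harmless, since the set of points is nonempty. -/
theorem loops_sub_one_eq_zero_iff (D : FourPlat) (s : D.State) :
    D.loops s - 1 = 0 ↔ IsConnected adjacentCap D.rightCap D.word s := by
  rw [← subsingleton_quot_joined_iff, ← Finite.card_le_one_iff_subsingleton, loops]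
  omega

/-! ### Removing the leftmost crossing -/

theorem isConnected_cons_iff (L R : Fin 4 → Fin 4) (c : PlatCrossing) (l : List PlatCrossing)
    (b : Bool) (s : Fin l.length → Bool) :
    IsConnected L R (c :: l) (Fin.cons b s : Fin (l.length + 1) → Bool) ↔
      ∀ (g : Fin 4 → Prop) (f : Fin (l.length + 1) → Fin 4 → Prop), (∀ i, g i = g (L i)) →
        SmoothingCompatible c (HorizontalSmoothing c b) g (f 0) →
        (∀ i, f (Fin.last _) i = f (Fin.last _) (R i)) →
        (∀ j : Fin l.length, SmoothingCompatible (l.get j) (HorizontalSmoothing (l.get j) (s j))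
          (f j.castSucc) (f j.succ)) → (∀ i, g i = g 0) ∧ ∀ j i, f j i = g 0 := by
  constructor
  · intro h g f hg hc hr hj
    have := h (Fin.cons g f : Fin (l.length + 1 + 1) → Fin 4 → Prop) hg hr
      (fun j => by
        refine Fin.cases ?_ (fun j => ?_) j
        · exact hc
        · exact hj j)
    exact ⟨fun i => this 0 i, fun j i => this j.succ i⟩
  · intro h f hl hr hj
    obtain ⟨h1, h2⟩ := h (f 0) (fun j => f j.succ) hl (hj 0) hr (fun j => hj j.succ)
    intro j i
    exact Fin.cases (motive := fun j => f j i = f 0 0) (h1 i) (fun j => h2 j i) j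

theorem isConnected_cons_horizontal (L R : Fin 4 → Fin 4) {c : PlatCrossing}
    (l : List PlatCrossing) {b : Bool} (hb : HorizontalSmoothing c b) (s : Fin l.length → Bool) :
    IsConnected L R (c :: l) (Fin.cons b s : Fin (l.length + 1) → Bool) ↔ IsConnected L R l s := by
  rw [isConnected_cons_iff]
  constructor
  · intro h f hl hr hj
    exact (h (f 0) f hl ⟨fun _ _ _ => rfl, fun _ => ⟨rfl, rfl⟩, fun h => absurd hb h⟩ hr hj).2
  · intro h g f hg hc hr hj
    have hgf : g = f 0 := by
      funext i
      by_cases hu : i = c.upper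
      · rw [hu, (hc.2.1 hb).1]
      by_cases hl : i = c.lower
      · rw [hl, (hc.2.1 hb).2]
      exact hc.1 i hu hl
    subst hgf
    have := h f hg hr hj
    exact ⟨this 0, this⟩

theorem smoothingCompatible_vertical_one {t : ℤˣ} {hor : Prop} (hb : ¬ hor) (g h : Fin 4 → Prop) :
    SmoothingCompatible ⟨1, t⟩ hor g h ↔ g 0 = h 0 ∧ g 3 = h 3 ∧ g 1 = g 2 ∧ h 1 = h 2 := by
  have hu : PlatCrossing.upper ⟨1, t⟩ = 1 := rfl
  have hl : PlatCrossing.lower ⟨1, t⟩ = 2 := rfl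
  rw [SmoothingCompatible, hu, hl]
  simp [Fin.forall_fin_succ, hb]
  tauto

theorem smoothingCompatible_vertical_zero {t : ℤˣ} {hor : Prop} (hb : ¬ hor) (g h : Fin 4 → Prop) :
    SmoothingCompatible ⟨0, t⟩ hor g h ↔ g 2 = h 2 ∧ g 3 = h 3 ∧ g 0 = g 1 ∧ h 0 = h 1 := by
  have hu : PlatCrossing.upper ⟨0, t⟩ = 0 := rfl
  have hl : PlatCrossing.lower ⟨0, t⟩ = 1 := rfl
  rw [SmoothingCompatible, hu, hl]
  simp [Fin.forall_fin_succ, hb]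
  tauto

theorem invariant_adjacentCap_iff (g : Fin 4 → Prop) :
    (∀ i, g i = g (adjacentCap i)) ↔ g 0 = g 1 ∧ g 2 = g 3 := by
  simp [Fin.forall_fin_succ, adjacentCap]
  tauto

theorem invariant_nestedCap_iff (g : Fin 4 → Prop) :
    (∀ i, g i = g (nestedCap i)) ↔ g 0 = g 3 ∧ g 1 = g 2 := by
  simp [Fin.forall_fin_succ, nestedCap]
  tauto

/-- The west arc links the two cap arcs into a path `0-1-2-3`, which now joins the outer strands,
while the east arc joins the inner ones: together a nested cap. -/
theorem isConnected_adjacent_cons_one {R : Fin 4 → Fin 4} {t : ℤˣ} (l : List PlatCrossing)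
    {b : Bool} (hb : ¬ HorizontalSmoothing ⟨1, t⟩ b) (s : Fin l.length → Bool) :
    IsConnected adjacentCap R (⟨1, t⟩ :: l) (Fin.cons b s : Fin (l.length + 1) → Bool) ↔
      IsConnected nestedCap R l s := by
  simp only [isConnected_cons_iff, smoothingCompatible_vertical_one hb, invariant_adjacentCap_iff]
  constructor
  · intro h f hl hr hj
    rw [invariant_nestedCap_iff] at hl
    exact (h (fun _ => f 0 0) f ⟨rfl, rfl⟩ ⟨rfl, hl.1, rfl, hl.2⟩ hr hj).2
  · rintro h g f ⟨h01, h23⟩ ⟨h0, h3, h12, k12⟩ hr hj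
    have := h f ((invariant_nestedCap_iff _).2 ⟨by rw [← h0, ← h3, h01, h12, h23], k12⟩) hr hj
    rw [h0]
    refine ⟨?_, this⟩
    rw [← h0]
    simp [Fin.forall_fin_succ, ← h23, ← h12, ← h01]

/-- The west arc links the nested arcs into a path `3-0-1-2`, which joins the two lower strands; the
east arc joins the two upper ones. -/
theorem isConnected_nested_cons_zero {R : Fin 4 → Fin 4} {t : ℤˣ} (l : List PlatCrossing)
    {b : Bool} (hb : ¬ HorizontalSmoothing ⟨0, t⟩ b) (s : Fin l.length → Bool) :
    IsConnected nestedCap R (⟨0, t⟩ :: l) (Fin.cons b s : Fin (l.length + 1) → Bool) ↔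
      IsConnected adjacentCap R l s := by
  simp only [isConnected_cons_iff, smoothingCompatible_vertical_zero hb, invariant_nestedCap_iff]
  constructor
  · intro h f hl hr hj
    rw [invariant_adjacentCap_iff] at hl
    -- The left labels must be `f 0 2`: only strands 2 and 3 continue through the crossing.
    have := (h (fun _ => f 0 2) f ⟨rfl, rfl⟩ ⟨rfl, hl.2, rfl, hl.1⟩ hr hj).2
    intro j i
    rw [this, this 0 0]
  · rintro h g f ⟨h03, h12⟩ ⟨h2, h3, h01, k01⟩ hr hj
    have := h f ((invariant_adjacentCap_iff _).2 ⟨k01, by rw [← h2, ← h3, ← h03, h01, h12]⟩) hr hj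
    refine ⟨by simp [Fin.forall_fin_succ, ← h03, ← h12, ← h01], fun j i => ?_⟩
    rw [this, ← this 0 3, ← h3, h03]

theorem not_isConnected_nested_cons_one {R : Fin 4 → Fin 4} {t : ℤˣ} (l : List PlatCrossing)
    {b : Bool} (hb : ¬ HorizontalSmoothing ⟨1, t⟩ b) (s : Fin l.length → Bool) :
    ¬ IsConnected nestedCap R (⟨1, t⟩ :: l) (Fin.cons b s : Fin (l.length + 1) → Bool) := by
  simp only [isConnected_cons_iff, smoothingCompatible_vertical_one hb, invariant_nestedCap_iff]
  intro h
  -- The west arc and the inner cap arc form a closed curve; this labelling is its indicator.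
  have := (h (fun i => i = 1 ∨ i = 2) (fun _ _ => False) (by simp) (by simp) (fun _ => rfl)
    (fun _ => ⟨fun _ _ _ => rfl, fun _ => ⟨rfl, rfl⟩, fun _ => ⟨rfl, rfl⟩⟩)).1 1
  simp at this

theorem not_isConnected_adjacent_cons_zero {R : Fin 4 → Fin 4} {t : ℤˣ} (l : List PlatCrossing)
    {b : Bool} (hb : ¬ HorizontalSmoothing ⟨0, t⟩ b) (s : Fin l.length → Bool) :
    ¬ IsConnected adjacentCap R (⟨0, t⟩ :: l) (Fin.cons b s : Fin (l.length + 1) → Bool) := by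
  simp only [isConnected_cons_iff, smoothingCompatible_vertical_zero hb, invariant_adjacentCap_iff]
  intro h
  -- The indicator of the closed curve formed by the west arc and the upper cap arc.
  have := (h (fun i => i = 0 ∨ i = 1) (fun _ _ => False) (by simp) (by simp) (fun _ => rfl)
    (fun _ => ⟨fun _ _ _ => rfl, fun _ => ⟨rfl, rfl⟩, fun _ => ⟨rfl, rfl⟩⟩)).1 2
  simp at this

theorem isConnected_nil_iff (L R : Fin 4 → Fin 4) (s : Fin ([] : List PlatCrossing).length → Bool) :
    IsConnected L R [] s ↔ ∀ g : Fin 4 → Prop, (∀ i, g i = g (L i)) → (∀ i, g i = g (R i)) →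
      ∀ i, g i = g 0 := by
  constructor
  · intro h g hl hr i
    exact h (fun _ => g) hl hr (fun j => j.elim0) 0 i
  · intro h f hl hr _ j i
    obtain rfl : j = 0 := Subsingleton.elim (α := Fin 1) _ _
    exact h (f 0) hl hr i

theorem not_isConnected_adjacent_nil (s) : ¬ IsConnected adjacentCap adjacentCap [] s := by
  simp only [isConnected_nil_iff, invariant_adjacentCap_iff]
  intro h
  simpa using h (fun i => i = 0 ∨ i = 1) (by simp) (by simp) 2

theorem not_isConnected_nested_nil (s) : ¬ IsConnected nestedCap nestedCap [] s := by
  simp only [isConnected_nil_iff, invariant_nestedCap_iff]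
  intro h
  simpa using h (fun i => i = 0 ∨ i = 3) (by simp) (by simp) 1

theorem isConnected_adjacent_nested_nil (s) : IsConnected adjacentCap nestedCap [] s := by
  simp only [isConnected_nil_iff, invariant_nestedCap_iff, invariant_adjacentCap_iff]
  rintro g ⟨h01, h23⟩ ⟨h03, h12⟩
  simp [Fin.forall_fin_succ, ← h03, ← h12, ← h01]

theorem isConnected_nested_adjacent_nil (s) : IsConnected nestedCap adjacentCap [] s := by
  simp only [isConnected_nil_iff, invariant_nestedCap_iff, invariant_adjacentCap_iff]
  rintro g ⟨h03, h12⟩ ⟨h01, h23⟩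
  simp [Fin.forall_fin_succ, ← h03, ← h12, ← h01]

/-! ### The state sum over single-loop states -/

/-- The factor of a smoothing in the state sum with variable `A`. -/
def smoothingWeight (A : ℂˣ) (b : Bool) : ℂˣ := if b then A else A⁻¹

open Classical in
/-- The state sum with variable `A`, restricted to states with a single loop, of the diagram with
left cap `L`, crossings `l` and right cap `R`. -/
noncomputable def connectedSum (A : ℂˣ) (L R : Fin 4 → Fin 4) (l : List PlatCrossing) : ℂ :=
  ∑ s : Fin l.length → Bool,
    ((∏ j, smoothingWeight A (s j) : ℂˣ) : ℂ) * if IsConnected L R l s then 1 else 0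

open Classical in
theorem connectedSum_nil (A : ℂˣ) (L R : Fin 4 → Fin 4) :
    connectedSum A L R [] = if IsConnected L R [] Fin.elim0 then 1 else 0 := by
  rw [connectedSum]
  change ∑ s : Fin 0 → Bool, ((∏ j : Fin 0, smoothingWeight A (s j) : ℂˣ) : ℂ) *
    (if IsConnected L R [] s then (1 : ℂ) else 0) = _
  rw [Fintype.sum_subsingleton _ (Fin.elim0 : Fin 0 → Bool)]
  simp

open Classical in
theorem connectedSum_cons (A : ℂˣ) (L R : Fin 4 → Fin 4) (c : PlatCrossing)
    (l : List PlatCrossing) :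
    connectedSum A L R (c :: l) = ∑ b : Bool, (smoothingWeight A b : ℂ) *
      ∑ s : Fin l.length → Bool, ((∏ j, smoothingWeight A (s j) : ℂˣ) : ℂ) *
        if IsConnected L R (c :: l) (Fin.cons b s : Fin (l.length + 1) → Bool) then 1 else 0 := by
  rw [connectedSum]
  change ∑ s : Fin (l.length + 1) → Bool,
    ((∏ j : Fin (l.length + 1), smoothingWeight A (s j) : ℂˣ) : ℂ) * _ = _
  rw [← (Fin.consEquiv fun _ : Fin (l.length + 1) => Bool).sum_comp, Fintype.sum_prod_type]
  refine Finset.sum_congr rfl fun b _ => ?_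
  rw [Finset.mul_sum]
  refine Finset.sum_congr rfl fun s _ => ?_
  simp only [Fin.consEquiv_apply, Fin.prod_univ_succ, Fin.cons_zero, Fin.cons_succ, Units.val_mul,
    mul_assoc]
  rfl

/-- The smoothing of a crossing that has two horizontal arcs. -/
def horizontalChoice (c : PlatCrossing) : Bool := decide (c.twist = -1)

theorem horizontalSmoothing_horizontalChoice (c : PlatCrossing) :
    HorizontalSmoothing c (horizontalChoice c) := by
  rcases Int.units_eq_one_or c.twist with h | h <;> simp [HorizontalSmoothing, horizontalChoice, h]

theorem not_horizontalSmoothing_not_horizontalChoice (c : PlatCrossing) :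
    ¬ HorizontalSmoothing c (!horizontalChoice c) := by
  rcases Int.units_eq_one_or c.twist with h | h <;> simp [HorizontalSmoothing, horizontalChoice, h]

open Classical in
theorem connectedSum_cons_eq_horizontal_add (A : ℂˣ) (L R : Fin 4 → Fin 4) (c : PlatCrossing)
    (l : List PlatCrossing) :
    connectedSum A L R (c :: l) =
      (smoothingWeight A (horizontalChoice c) : ℂ) * connectedSum A L R l +
      (smoothingWeight A (!horizontalChoice c) : ℂ) *
        ∑ s : Fin l.length → Bool, ((∏ j, smoothingWeight A (s j) : ℂˣ) : ℂ) *
          if IsConnected L R (c :: l)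
            (Fin.cons (!horizontalChoice c) s : Fin (l.length + 1) → Bool) then 1 else 0 := by
  have hsum : ∀ (F : Bool → ℂ) (b : Bool), ∑ b, F b = F b + F (!b) := by
    intro F b
    cases b <;> simp [add_comm]
  rw [connectedSum_cons, hsum _ (horizontalChoice c), connectedSum]
  simp only [isConnected_cons_horizontal L R l (horizontalSmoothing_horizontalChoice c)]

theorem connectedSum_adjacent_cons_one (A : ℂˣ) (R : Fin 4 → Fin 4) (l : List PlatCrossing) :
    connectedSum A adjacentCap R (⟨1, 1⟩ :: l) =
      (A⁻¹ : ℂˣ) * connectedSum A adjacentCap R l + A * connectedSum A nestedCap R l := by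
  rw [connectedSum_cons_eq_horizontal_add]
  classical
  have h (s : Fin l.length → Bool) := isConnected_adjacent_cons_one (R := R) l
    (not_horizontalSmoothing_not_horizontalChoice ⟨1, 1⟩) s
  simp only [h]
  rfl

theorem connectedSum_nested_cons_one (A : ℂˣ) (R : Fin 4 → Fin 4) (l : List PlatCrossing) :
    connectedSum A nestedCap R (⟨1, 1⟩ :: l) = (A⁻¹ : ℂˣ) * connectedSum A nestedCap R l := by
  rw [connectedSum_cons_eq_horizontal_add]
  simp only [not_isConnected_nested_cons_one l (not_horizontalSmoothing_not_horizontalChoice _)]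
  simp [smoothingWeight, show horizontalChoice ⟨1, 1⟩ = false from rfl]

theorem connectedSum_nested_cons_zero (A : ℂˣ) (R : Fin 4 → Fin 4) (l : List PlatCrossing) :
    connectedSum A nestedCap R (⟨0, -1⟩ :: l) =
      A * connectedSum A nestedCap R l + (A⁻¹ : ℂˣ) * connectedSum A adjacentCap R l := by
  rw [connectedSum_cons_eq_horizontal_add]
  classical
  have h (s : Fin l.length → Bool) := isConnected_nested_cons_zero (R := R) l
    (not_horizontalSmoothing_not_horizontalChoice ⟨0, -1⟩) s
  simp only [h]
  rfl

theorem connectedSum_adjacent_cons_zero (A : ℂˣ) (R : Fin 4 → Fin 4) (l : List PlatCrossing) :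
    connectedSum A adjacentCap R (⟨0, -1⟩ :: l) = A * connectedSum A adjacentCap R l := by
  rw [connectedSum_cons_eq_horizontal_add]
  simp only [not_isConnected_adjacent_cons_zero l (not_horizontalSmoothing_not_horizontalChoice _)]
  simp [smoothingWeight, show horizontalChoice ⟨0, -1⟩ = true from rfl]

theorem inv_val_eq_of_sq_eq_I {A : ℂˣ} (hA : (A : ℂ) ^ 2 = Complex.I) :
    ((A⁻¹ : ℂˣ) : ℂ) = -Complex.I * A := by
  have h : -Complex.I * (A : ℂ) * A = 1 := by
    rw [mul_assoc, ← sq, hA]; simp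
  rw [Units.inv_eq_of_mul_eq_one_left (u := A) h]

/-- A second vertical smoothing in the same box would close a curve. So at most one occurs, in `m`
possible places, and it multiplies the weight `A ^ (-m)` of the all-horizontal choice by `A ^ 2 =
i`. -/
theorem connectedSum_replicate_one {A : ℂˣ} (hA : (A : ℂ) ^ 2 = Complex.I)
    (R : Fin 4 → Fin 4) (m : ℕ) (l : List PlatCrossing) :
    connectedSum A adjacentCap R (List.replicate m ⟨1, 1⟩ ++ l) = ((A⁻¹ : ℂˣ) : ℂ) ^ m *
      (connectedSum A adjacentCap R l + m * Complex.I * connectedSum A nestedCap R l) ∧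
    connectedSum A nestedCap R (List.replicate m ⟨1, 1⟩ ++ l) =
      ((A⁻¹ : ℂˣ) : ℂ) ^ m * connectedSum A nestedCap R l := by
  have h : (A : ℂ) = ((A⁻¹ : ℂˣ) : ℂ) * Complex.I := by
    rw [inv_val_eq_of_sq_eq_I hA]
    linear_combination (A : ℂ) * Complex.I_sq
  induction m with
  | zero => simp
  | succ m ih =>
    rw [List.replicate_succ, List.cons_append, connectedSum_adjacent_cons_one,
      connectedSum_nested_cons_one, ih.1, ih.2]
    constructor
    · rw [Nat.cast_succ]
      generalize ((A⁻¹ : ℂˣ) : ℂ) = B at h ⊢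
      linear_combination B ^ m * connectedSum A nestedCap R l * h
    · ring

/-- The same count with the caps and the smoothing weights exchanged; the single vertical smoothing
contributes `A ^ (-2) = -i`. -/
theorem connectedSum_replicate_zero {A : ℂˣ} (hA : (A : ℂ) ^ 2 = Complex.I)
    (R : Fin 4 → Fin 4) (m : ℕ) (l : List PlatCrossing) :
    connectedSum A nestedCap R (List.replicate m ⟨0, -1⟩ ++ l) = (A : ℂ) ^ m *
      (connectedSum A nestedCap R l - m * Complex.I * connectedSum A adjacentCap R l) ∧
    connectedSum A adjacentCap R (List.replicate m ⟨0, -1⟩ ++ l) =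
      (A : ℂ) ^ m * connectedSum A adjacentCap R l := by
  induction m with
  | zero => simp
  | succ m ih =>
    rw [List.replicate_succ, List.cons_append, connectedSum_nested_cons_zero,
      connectedSum_adjacent_cons_zero, ih.1, ih.2, inv_val_eq_of_sq_eq_I hA]
    constructor
    · push_cast
      ring
    · ring

/-! ### Twist boxes and continuants -/

/-- The twist boxes of the standard diagram, where the first one has the index `k`. -/
def twistBoxes : ℕ → List ℕ → List PlatCrossing
  | _, [] => []
  | k, m :: l =>
    List.replicate m ⟨if Even k then 1 else 0, if Even k then 1 else -1⟩ ++ twistBoxes (k + 1) l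

/-- The numerator and the denominator of the continued fraction `[0, m₁, …, mₙ]`. -/
def continuants : List ℕ → ℕ × ℕ
  | [] => (0, 1)
  | m :: l => ((continuants l).2, m * (continuants l).2 + (continuants l).1)

/-- Each box mixes the sums for the two left caps, so both are carried through the induction.
Removing a box shifts the parity of the first index, hence the quantification over `k`. The cap that
the next box can change carries the denominator, the other one the numerator times `±i`; box `k`
contributes the factor `(-1) ^ k * i` and a power of `A`. -/
theorem connectedSum_twistBoxes {A : ℂˣ} (hA : (A : ℂ) ^ 2 = Complex.I) (l : List ℕ) :
    ∀ k : ℕ, ∃ u : ℂ,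
      u = (∏ j ∈ Finset.range l.length, (-1) ^ (k + j) * Complex.I) *
        ((A ^ (∑ j : Fin l.length, (-1) ^ (k + j + 1) * (l.get j : ℤ)) : ℂˣ) : ℂ) ∧
      connectedSum A adjacentCap (if Even (k + l.length) then nestedCap else adjacentCap)
        (twistBoxes k l) =
          u * (if Even k then ((continuants l).2 : ℂ) else Complex.I * (continuants l).1) ∧
      connectedSum A nestedCap (if Even (k + l.length) then nestedCap else adjacentCap)
        (twistBoxes k l) =
          u * (if Even k then -Complex.I * ((continuants l).1 : ℂ) else (continuants l).2) := by
  induction l with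
  | nil =>
    intro k
    refine ⟨1, by simp, ?_⟩
    by_cases hk : Even k <;>
      simp [hk, twistBoxes, continuants, connectedSum_nil, not_isConnected_adjacent_nil,
        not_isConnected_nested_nil, isConnected_adjacent_nested_nil,
        isConnected_nested_adjacent_nil]
  | cons m l ih =>
    intro k
    obtain ⟨u, hu, h1, h2⟩ := ih (k + 1)
    have hlen : k + (m :: l).length = k + 1 + l.length := by simp; ring
    rw [hlen]
    refine ⟨_, rfl, ?_⟩
    have hI := Complex.I_sq
    have hexp : (A ^ (∑ j : Fin (m :: l).length, (-1) ^ (k + j + 1) * ((m :: l).get j : ℤ)) : ℂˣ) =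
        A ^ ((-1) ^ (k + 1) * (m : ℤ)) *
          A ^ (∑ j : Fin l.length, (-1) ^ (k + 1 + j + 1) * (l.get j : ℤ)) := by
      rw [← zpow_add]
      congr 1
      change ∑ j : Fin (l.length + 1), (-1) ^ (k + (j : ℕ) + 1) * ((m :: l).get j : ℤ) = _
      rw [Fin.sum_univ_succ]
      congr 1
      refine Finset.sum_congr rfl fun j _ => ?_
      rw [Fin.val_succ, add_right_comm k 1, ← add_assoc k]
      rfl
    have hprod : ∏ j ∈ Finset.range (m :: l).length, (-1) ^ (k + j) * Complex.I =
        (-1) ^ k * Complex.I * ∏ j ∈ Finset.range l.length, (-1) ^ (k + 1 + j) * Complex.I := by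
      rw [List.length_cons, Finset.prod_range_succ', mul_comm]
      congr 1
      refine Finset.prod_congr rfl fun j _ => ?_
      rw [add_right_comm k 1, ← add_assoc k]
    have hU : (∏ j ∈ Finset.range (m :: l).length, (-1) ^ (k + j) * Complex.I) *
        ((A ^ (∑ j : Fin (m :: l).length, (-1) ^ (k + j + 1) * ((m :: l).get j : ℤ)) : ℂˣ) : ℂ) =
        (-1) ^ k * Complex.I * ((A ^ ((-1) ^ (k + 1) * (m : ℤ)) : ℂˣ) : ℂ) * u := by
      rw [hexp, hprod, hu, Units.val_mul]
      ring
    rw [hU]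
    generalize (if Even (k + 1 + l.length) then nestedCap else adjacentCap) = R at h1 h2 ⊢
    by_cases hk : Even k
    · have hk' : ¬ Even (k + 1) := by simpa [Nat.even_add_one] using hk
      obtain ⟨r1, r2⟩ := connectedSum_replicate_one hA R m (twistBoxes (k + 1) l)
      have hz : ((A ^ ((-1) ^ (k + 1) * (m : ℤ)) : ℂˣ) : ℂ) = ((A⁻¹ : ℂˣ) : ℂ) ^ m := by
        rw [pow_succ, hk.neg_one_pow, one_mul, neg_one_mul, zpow_neg, zpow_natCast, ← inv_pow,
          Units.val_pow_eq_pow_val]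
      simp only [twistBoxes, hk, if_true, r1, r2, h1, h2, hk', if_false, continuants, hz,
        hk.neg_one_pow]
      generalize ((A⁻¹ : ℂˣ) : ℂ) ^ m = B
      push_cast
      constructor
      · ring
      · linear_combination B * u * (continuants l).2 * hI
    · have hk' : Even (k + 1) := by simpa [Nat.even_add_one] using hk
      have hk2 := Nat.not_even_iff_odd.1 hk
      obtain ⟨r1, r2⟩ := connectedSum_replicate_zero hA R m (twistBoxes (k + 1) l)
      have hz : ((A ^ ((-1) ^ (k + 1) * (m : ℤ)) : ℂˣ) : ℂ) = (A : ℂ) ^ m := by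
        rw [hk'.neg_one_pow, one_mul, zpow_natCast, Units.val_pow_eq_pow_val]
      simp only [twistBoxes, hk, if_true, r1, r2, h1, h2, hk', if_false, continuants, hz,
        hk2.neg_one_pow]
      generalize (A : ℂ) ^ m = B
      push_cast
      constructor
      · linear_combination B * u * (continuants l).2 * hI
      · ring

theorem flatten_ofFn_eq_twistBoxes {n : ℕ} (a : Fin n → ℤ) (ha : ∀ k, 0 < a k) (r : ℕ) :
    (List.ofFn fun k : Fin n =>
      List.replicate (a k).natAbs
        { pos := if Even (r + k) then 1 else 0
          twist := (-1) ^ (r + k) * (if 0 < a k then 1 else -1) : PlatCrossing }).flatten =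
      twistBoxes r (List.ofFn fun k => (a k).natAbs) := by
  induction n generalizing r with
  | zero => simp [twistBoxes]
  | succ n ih =>
    have := ih (fun k => a k.succ) (fun k => ha k.succ) (r + 1)
    rw [List.ofFn_succ, List.ofFn_succ, List.flatten_cons, twistBoxes, ← this]
    congr 1
    · by_cases hr : Even r
      · simp [ha, hr, hr.neg_one_pow]
      · simp [ha, hr, (Nat.not_even_iff_odd.1 hr).neg_one_pow]
    · simp only [Fin.val_succ, add_assoc, add_comm 1]

theorem standard_word {n : ℕ} (a : Fin n → ℤ) (ha : ∀ k, 0 < a k) :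
    (standard a).word = twistBoxes 0 (List.ofFn fun k => (a k).natAbs) := by
  rw [← flatten_ofFn_eq_twistBoxes a ha 0]
  simp [standard]

/-! ### Evaluation of the bracket and the Jones polynomial -/

/-- The value of a Laurent polynomial with integer coefficients at a complex number. -/
noncomputable def evalHom (A : ℂˣ) : ℤ[T;T⁻¹] →+* ℂ :=
  LaurentPolynomial.eval₂ (Int.castRingHom ℂ) A

theorem evalHom_T (A : ℂˣ) (m : ℤ) :
    evalHom A (LaurentPolynomial.T m) = ((A ^ m : ℂˣ) : ℂ) := by
  simp [evalHom]

theorem evalHom_bracket {A : ℂˣ} (hA : (A : ℂ) ^ 2 = Complex.I) (D : FourPlat) :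
    evalHom A D.bracket = connectedSum A adjacentCap D.rightCap D.word := by
  have hloop : evalHom A (-LaurentPolynomial.T 2 - LaurentPolynomial.T (-2)) = 0 := by
    have h2 : ((A ^ (2 : ℤ) : ℂˣ) : ℂ) = Complex.I := by
      rw [← hA]; norm_cast
    have h3 : ((A ^ (-2 : ℤ) : ℂˣ) : ℂ) = -Complex.I := by
      rw [zpow_neg, Units.val_inv_eq_inv_val, h2, Complex.inv_I]
    rw [map_sub, map_neg, evalHom_T, evalHom_T, h2, h3]
    ring
  classical
  rw [bracket, map_sum, connectedSum]
  refine Finset.sum_congr rfl fun s _ => ?_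
  rw [map_mul, map_pow, hloop, evalHom_T, zero_pow_eq]
  congr 1
  · rw [stateExponent]
    congr 1
    have hsum (t : Finset (Fin D.size)) :
        A ^ (∑ j ∈ t, if s j then (1 : ℤ) else -1) = ∏ j ∈ t, smoothingWeight A (s j) := by
      classical
      induction t using Finset.induction_on with
      | empty => simp
      | insert j t hj ih =>
        rw [Finset.sum_insert hj, Finset.prod_insert hj, zpow_add, ih]
        cases s j <;> simp [smoothingWeight]
    exact hsum _
  · simp only [loops_sub_one_eq_zero_iff]

theorem evalHom_invert (A : ℂˣ) (f : ℤ[T;T⁻¹]) :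
    evalHom A⁻¹ (LaurentPolynomial.invert f) = evalHom A f := by
  induction f using LaurentPolynomial.induction_on' with
  | add p q hp hq => rw [map_add, map_add, map_add, hp, hq]
  | C_mul_T m r => simp [evalHom]

/-- Since `-1 = A ^ 4`, the normalization `(-A ^ (-3)) ^ w` equals `A ^ (4 w - 3 w) = A ^ w`. -/
theorem Orientation.jonesEval_inv {A : ℂˣ} (hA : (A : ℂ) ^ 2 = Complex.I) {D : FourPlat}
    (o : D.Orientation) :
    o.jonesEval A⁻¹ =
      ((A ^ o.writhe : ℂˣ) : ℂ) * connectedSum A adjacentCap D.rightCap D.word := by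
  have h4 : A ^ (4 : ℤ) = -1 := by
    ext
    have : (A : ℂ) ^ 4 = ((A : ℂ) ^ 2) ^ 2 := by ring
    rw [hA, Complex.I_sq] at this
    rw [Units.val_zpow_eq_zpow_val]
    simpa using (zpow_natCast (A : ℂ) 4).trans this
  have hw : ((o.writhe.negOnePow : ℤˣ) : ℤ) = (((-1 : ℂˣ) ^ o.writhe : ℂˣ) : ℂ) := by
    rw [Int.negOnePow_def]
    rcases Int.even_or_odd o.writhe with h | h
    · simp [h.neg_one_zpow]
    · simp [h.neg_one_zpow]
  change evalHom A⁻¹ (LaurentPolynomial.invert o.normalizedBracket) = _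
  rw [evalHom_invert, normalizedBracket, map_mul, map_mul, evalHom_bracket hA, evalHom_T]
  congr 1
  have hC : evalHom A (LaurentPolynomial.C ((o.writhe.negOnePow : ℤˣ) : ℤ)) =
      (((-1 : ℂˣ) ^ o.writhe : ℂˣ) : ℂ) := by
    rw [← hw]
    simp [evalHom]
  rw [hC, ← Units.val_mul, ← h4, ← zpow_mul, ← zpow_add]
  congr 2
  ring

/-! ### Arithmetic of the continued fraction -/

theorem continuants_pos_coprime (l : List ℕ) (hl : ∀ m ∈ l, 0 < m) :
    0 < (continuants l).2 ∧ (continuants l).1.Coprime (continuants l).2 := by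
  induction l with
  | nil => simp [continuants]
  | cons m l ih =>
    obtain ⟨h1, h2⟩ := ih fun x hx => hl x (List.mem_cons_of_mem _ hx)
    refine ⟨?_, ?_⟩
    · have := Nat.mul_pos (hl m List.mem_cons_self) h1
      simp only [continuants]
      omega
    · simpa [continuants] using h2.symm

theorem contFracValue_eq_continuants (l : List ℕ) (hl : ∀ m ∈ l, 0 < m) :
    contFracValue (l.map (fun m : ℕ => (m : ℤ))) = ((continuants l).1 : ℚ) / (continuants l).2 := by
  induction l with
  | nil => simp [contFracValue, continuants]
  | cons m l ih =>
    have hl' : ∀ x ∈ l, 0 < x := fun x hx => hl x (List.mem_cons_of_mem _ hx)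
    have h1 : ((continuants l).2 : ℚ) ≠ 0 := by
      exact_mod_cast (continuants_pos_coprime l hl').1.ne'
    rw [List.map_cons, contFracValue, ih hl', continuants]
    push_cast
    rw [show (m : ℚ) + ((continuants l).1 : ℚ) / (continuants l).2 =
      (m * (continuants l).2 + (continuants l).1) / (continuants l).2 by field_simp, one_div_div]

/-- Both fractions are in lowest terms, so their denominators divide each other. -/
theorem continuants_snd_eq {l : List ℕ} (hl : ∀ m ∈ l, 0 < m) {p q : ℕ} (hq : 0 < q)
    (hpq : p.Coprime q) (h : contFracValue (l.map (fun m : ℕ => (m : ℤ))) = (p : ℚ) / q) :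
    (continuants l).2 = q := by
  obtain ⟨h1, h2⟩ := continuants_pos_coprime l hl
  rw [contFracValue_eq_continuants l hl] at h
  have h3 : ((continuants l).1 : ℚ) * q = p * (continuants l).2 :=
    (div_eq_div_iff (by exact_mod_cast h1.ne') (by exact_mod_cast hq.ne')).1 h
  have h4 : (continuants l).1 * q = p * (continuants l).2 := by exact_mod_cast h3
  exact Nat.dvd_antisymm (h2.symm.dvd_of_dvd_mul_left (Dvd.intro_left _ h4.symm))
    (hpq.symm.dvd_of_dvd_mul_left (Dvd.intro_left _ h4))

theorem prod_neg_one_pow_mul_I (n : ℕ) :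
    ∏ j ∈ Finset.range n, (-1) ^ (0 + j) * Complex.I = (-1) ^ n.choose 2 * Complex.I ^ n := by
  simp only [zero_add]
  rw [Finset.prod_mul_distrib, Finset.prod_pow_eq_pow_sum, Finset.prod_const, Finset.card_range,
    Finset.sum_range_id, Nat.choose_two_right]

end FourPlat

/-! ### The value at `t = -1` -/

theorem quarterRoot_inv_sq : ((quarterRoot⁻¹ : ℂˣ) : ℂ) ^ 2 = Complex.I := by
  have h : ((Real.sqrt 2 : ℝ) : ℂ) ^ 2 = 2 := by
    rw [← Complex.ofReal_pow, Real.sq_sqrt (by norm_num)]; norm_num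
  change ((1 + Complex.I) / (Real.sqrt 2 : ℂ)) ^ 2 = Complex.I
  rw [div_pow, h]
  linear_combination Complex.I_sq / 2

open FourPlat in
theorem theorem6p1 {n : ℕ} (a : Fin n → ℤ) (ha : ∀ k, 0 < a k)
    (p q : ℕ) (hp : 0 < p) (hq : 0 < q) (hpq : Nat.Coprime p q)
    (hcf : contFracValue (List.ofFn a) = (p : ℚ) / (q : ℚ))
    (o : (FourPlat.standard a).Orientation) :
    o.jonesEval quarterRoot =
      (-1) ^ (n.choose 2) * Complex.I ^ n *
        ((1 + Complex.I) / (Real.sqrt 2 : ℂ)) ^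
          (o.writhe + ∑ k : Fin n, (-1) ^ ((k : ℕ) + 1) * a k) * (q : ℂ) := by
  have hden : (continuants (List.ofFn fun k => (a k).natAbs)).2 = q := by
    refine continuants_snd_eq ?_ hq hpq ?_
    · intro m hm
      obtain ⟨k, rfl⟩ := (List.mem_ofFn' _ _).1 hm
      exact Int.natAbs_pos.2 (ha k).ne'
    · rw [← hcf, List.map_ofFn]
      congr 2
      funext k
      exact Int.natAbs_of_nonneg (ha k).le
  have hcap : (standard a).rightCap =
      if Even (0 + (List.ofFn fun k => (a k).natAbs).length) then nestedCap else adjacentCap := by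
    simp [rightCap, standard]
  have hexp : ∑ j : Fin (List.ofFn fun k => (a k).natAbs).length,
      (-1) ^ (0 + (j : ℕ) + 1) * ((List.ofFn fun k => (a k).natAbs).get j : ℤ) =
      ∑ k : Fin n, (-1) ^ ((k : ℕ) + 1) * a k := by
    refine Fintype.sum_equiv (finCongr (List.length_ofFn)) _ _ fun j => ?_
    simp [abs_of_pos (ha _)]
    rfl
  have hbase : (1 + Complex.I) / (Real.sqrt 2 : ℂ) = ((quarterRoot⁻¹ : ℂˣ) : ℂ) := rfl
  -- The bracket variable is `A = t ^ (-1/4)`, the inverse of `quarterRoot`. The diagram starts with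
  -- an adjacent cap at the even index 0, so only the first formula, with the denominator, is
  -- needed.
  obtain ⟨u, hu, h, -⟩ :=
    connectedSum_twistBoxes quarterRoot_inv_sq (List.ofFn fun k => (a k).natAbs) 0
  have hj := Orientation.jonesEval_inv quarterRoot_inv_sq o
  rw [inv_inv, standard_word a ha, hcap, h, if_pos Even.zero, hden, hu, hexp, List.length_ofFn,
    prod_neg_one_pow_mul_I] at hj
  rw [hj, hbase, ← Units.val_zpow_eq_zpow_val, zpow_add, Units.val_mul]
  ring
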